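/- Theorem. Let $\lambda,\kappa\ge 0$ and $\gamma>0$, and let $(X_t,v_t)_{t\ge 0}$ be the Markov process on $\mathbb Z\times\{-1,1\}$ with generator $$Lf(x,v)=\lambda\big(f(x+v,v)-f(x,v)\big)+\kappa\big(f(x+1,v)+f(x-1,v)-2f(x,v)\big)+\gamma\big(f(x,-v)-f(x,v)\big),$$ acting on bounded functions, started from $X_0=0$ and $v_0=\pm1$ with probability $\tfrac12$ each. Put $$F(\alpha)=(2\kappa+\lambda)(\cosh\alpha-1)+\sqrt{\gamma^2+\lambda^2\sinh^2\alpha}-\gamma,\qquad I(x)=\sup_{\alpha\in\mathbb R}\big(\alpha x-F(\alpha)\big)\in[0,\infty].$$ (a) $X_t/t$ satisfies the large deviation principle with rate function $I$ as $t\to\infty$: $I$ is nonnegative and lower semicontinuous and, with $\log 0=-\infty$ and $\inf\emptyset=+\infty$, $$\limsup_{t\to\infty}\tfrac1t\log\mathbb P\big(\tfrac{X_t}{t}\in B\big)\le-\inf_{x\in B}I(x)\ \text{ for all closed } B\subset\mathbb R,\qquad \liminf_{t\to\infty}\tfrac1t\log\mathbb P\big(\tfrac{X_t}{t}\in G\big)\ge-\inf_{x\in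 G}I(x)\ \text{ for all open } G\subset\mathbb R.$$ (b) $F$ is the large deviation free energy of the position: for all $\alpha\in\mathbb R$, $\mathbb E(e^{\alpha X_t})<\infty$ for all $t\ge0$ and $\lim_{t\to\infty}\tfrac1t\log\mathbb E(e^{\alpha X_t})=F(\alpha)$. (c) For all $\alpha\in\mathbb R$, both eigenvalues of $M(-i\alpha)$ are real and $F(\alpha)$ is the largest one, where for $q\in\mathbb C$ $$M(q)=\begin{pmatrix}(2\kappa+\lambda)(\cos q-1)-\gamma+i\lambda\sin q&\gamma\\ \gamma&(2\kappa+\lambda)(\cos q-1)-\gamma-i\lambda\sin q\end{pmatrix}.$$ -/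

import Mathlib

open MeasureTheory ProbabilityTheory Filter Topology
open scoped NNReal ENNReal BoundedContinuousFunction

noncomputable section

namespace RunTumble

/-- The state space: a position in `ℤ` and a velocity in `ℤˣ = {1, -1}`. -/
abbrev State : Type := ℤ × ℤˣ

/-- The bounded operator `f ↦ f ∘ σ` on bounded functions on the (discrete) state space. -/
def pullback (σ : State → State) : (State →ᵇ ℝ) →L[ℝ] (State →ᵇ ℝ) :=
  LinearMap.mkContinuous
    { toFun := fun f => f.compContinuous ⟨σ, continuous_of_discreteTopology⟩
      map_add' := fun _ _ => rfl
      map_smul' := fun _ _ => rfl }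
    1
    (fun f => by
      rw [one_mul]
      exact (BoundedContinuousFunction.norm_le (norm_nonneg f)).2
        (fun p => f.norm_coe_le_norm (σ p)))

/-- The generator of the run-and-tumble particle, as a bounded operator on bounded functions:
with rate `lam` a jump in the direction of the velocity, with rate `κ` a jump to each of the two
neighbours, with rate `γ` a flip of the velocity. See `generator_apply`. -/
def generator (lam κ γ : ℝ) : (State →ᵇ ℝ) →L[ℝ] (State →ᵇ ℝ) :=
  lam • (pullback (fun p => (p.1 + (p.2 : ℤ), p.2)) - 1)
    + κ • (pullback (fun p => (p.1 + 1, p.2)) + pullback (fun p => (p.1 - 1, p.2)) - (2 : ℝ) • 1)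
    + γ • (pullback (fun p => (p.1, -p.2)) - 1)

theorem generator_apply (lam κ γ : ℝ) (f : State →ᵇ ℝ) (x : ℤ) (v : ℤˣ) :
    generator lam κ γ f (x, v)
      = lam * (f (x + (v : ℤ), v) - f (x, v))
        + κ * (f (x + 1, v) + f (x - 1, v) - 2 * f (x, v))
        + γ * (f (x, -v) - f (x, v)) :=
  rfl

/-- The semigroup `exp (t L)` generated by a bounded operator `L` on a normed space. -/
def expSemigroup {E : Type*} [NormedAddCommGroup E] [NormedSpace ℝ E] (L : E →L[ℝ] E) (t : ℝ) :
    E →L[ℝ] E :=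
  NormedSpace.exp (t • L)

/-- The Markov semigroup `exp (t L)` of the run-and-tumble particle. -/
def semigroup (lam κ γ : ℝ) (t : ℝ≥0) : (State →ᵇ ℝ) →L[ℝ] (State →ᵇ ℝ) :=
  expSemigroup (generator lam κ γ) (t : ℝ)

/-- `(X_t, V_t)` is the run-and-tumble particle with rates `lam`, `κ`, `γ`: a Markov process (with
respect to the filtration `ℱ`) whose semigroup is the one of the generator, started from position
`0` with a uniformly distributed velocity. -/
structure IsRunAndTumble {Ω : Type*} [mΩ : MeasurableSpace Ω] (lam κ γ : ℝ)
    (ℱ : Filtration ℝ≥0 mΩ) (X : ℝ≥0 → Ω → ℤ) (V : ℝ≥0 → Ω → ℤˣ) (μ : Measure Ω) : Prop where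
  measurable_position : ∀ t, Measurable[ℱ t] (X t)
  measurable_velocity : ∀ t, Measurable[ℱ t] (V t)
  markov : ∀ (s t : ℝ≥0) (f : State →ᵇ ℝ),
    μ[fun ω => f (X (s + t) ω, V (s + t) ω) | ℱ s]
      =ᵐ[μ] fun ω => semigroup lam κ γ t f (X s ω, V s ω)
  position_zero : ∀ᵐ ω ∂μ, X 0 ω = 0
  velocity_zero : ∀ v : ℤˣ, μ {ω | V 0 ω = v} = 1 / 2

/-- The large deviation principle (speed `t`, as `t → ∞`) for real random variables `Z_t` with rate
function `I`; `ENNReal.log 0 = -∞` and the infimum over the empty set is `+∞`. -/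
structure SatisfiesLDP {Ω : Type*} [MeasurableSpace Ω] (μ : Measure Ω) (Z : ℝ≥0 → Ω → ℝ)
    (I : ℝ → EReal) : Prop where
  nonneg : ∀ x, 0 ≤ I x
  lowerSemicontinuous : LowerSemicontinuous I
  upper_bound : ∀ B : Set ℝ, IsClosed B →
    limsup (fun t : ℝ≥0 => ((1 / (t : ℝ) : ℝ) : EReal) * ENNReal.log (μ {ω | Z t ω ∈ B})) atTop
      ≤ -(⨅ x ∈ B, I x)
  lower_bound : ∀ G : Set ℝ, IsOpen G →
    -(⨅ x ∈ G, I x)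
      ≤ liminf (fun t : ℝ≥0 => ((1 / (t : ℝ) : ℝ) : EReal) * ENNReal.log (μ {ω | Z t ω ∈ G})) atTop

/-- The Legendre transform `x ↦ sup_α (α x - F α)`, with values in `[-∞, ∞]`. -/
def legendre (F : ℝ → ℝ) (x : ℝ) : EReal :=
  ⨆ α : ℝ, ((α * x - F α : ℝ) : EReal)

/-- The explicit free energy function. -/
def freeEnergy (lam κ γ α : ℝ) : ℝ :=
  (2 * κ + lam) * (Real.cosh α - 1) + √(γ ^ 2 + lam ^ 2 * Real.sinh α ^ 2) - γ

/-- The matrix `M(q)` of the Fourier transformed master equation, rows and columns indexed by the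
velocities `1, -1`. For real `q` the two diagonal entries are complex conjugates; this is the
analytic continuation to complex `q`. -/
def fourierMatrix (lam κ γ : ℝ) (q : ℂ) : Matrix (Fin 2) (Fin 2) ℂ :=
  !![(2 * κ + lam) * (Complex.cos q - 1) - γ + Complex.I * lam * Complex.sin q, (γ : ℂ);
     (γ : ℂ), (2 * κ + lam) * (Complex.cos q - 1) - γ - Complex.I * lam * Complex.sin q]

end RunTumble

end

/-! With g the positive Perron eigenvector of the 2×2 velocity matrix, `exp (α x) * g v` is an
eigenfunction of the generator with eigenvalue F(α). Hence E[exp(α X_t) g(V_t)] = exp(t F(α))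
E[g(V_0)]. As g takes two positive values, E[exp(α X_t)] equals exp(t F(α)) up to constants
independent of t (`IsRunAndTumble.expMomentBounds`), which gives (b). The eigenfunction is unbounded
while the semigroup acts on bounded functions; truncation, finite propagation and dominated
convergence bridge this gap (`tendsto_semigroup_truncate`).

The large deviation principle uses these moment bounds alone, by the Gärtner–Ellis argument. The
upper bound is Chernoff's inequality on two half-lines, where F ≥ 0 = F(0) fixes the sign of the
tilt. The lower bound tilts by an η with F'(η) = x (`ExpMomentBounds.exists_le_measureReal`). Such
an η exists for every x because F is differentiable and grows at least quadratically, unless 2κ + λ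
= 0; then F = 0 and the rate is infinite off 0 (`legendre_freeEnergy_eq_top_or`). Part (c) is the
characteristic equation of a real symmetric 2×2 matrix. -/

namespace RunTumble

/-! ### The semigroup as a Poisson mixture of powers of the jump operator -/

/-- The gain part of the generator: `generator = jumpOperator - (lam + 2 κ + γ)`. -/
noncomputable def jumpOperator (lam κ γ : ℝ) : (State →ᵇ ℝ) →L[ℝ] (State →ᵇ ℝ) :=
  lam • pullback (fun p => (p.1 + (p.2 : ℤ), p.2))
    + κ • (pullback (fun p => (p.1 + 1, p.2)) + pullback (fun p => (p.1 - 1, p.2)))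
    + γ • pullback (fun p => (p.1, -p.2))

theorem jumpOperator_apply (lam κ γ : ℝ) (f : State →ᵇ ℝ) (x : ℤ) (v : ℤˣ) :
    jumpOperator lam κ γ f (x, v)
      = lam * f (x + (v : ℤ), v) + κ * (f (x + 1, v) + f (x - 1, v)) + γ * f (x, -v) :=
  rfl

theorem generator_eq_jumpOperator_sub (lam κ γ : ℝ) :
    generator lam κ γ = jumpOperator lam κ γ + (-(lam + 2 * κ + γ)) • 1 := by
  unfold generator jumpOperator
  module

theorem expSemigroup_add_smul_one {E : Type*} [NormedAddCommGroup E] [NormedSpace ℝ E]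
    [CompleteSpace E] (A : E →L[ℝ] E) (c t : ℝ) :
    expSemigroup (A + c • 1) t = Real.exp (c * t) • expSemigroup A t := by
  let +nondep : NormedAlgebra ℚ (E →L[ℝ] E) := .restrictScalars ℚ ℝ _
  have h1 : t • (A + c • 1) = t • A + algebraMap ℝ (E →L[ℝ] E) (c * t) := by
    rw [smul_add, Algebra.algebraMap_eq_smul_one, smul_smul, mul_comm]
  rw [expSemigroup, expSemigroup, h1, NormedSpace.exp_add_of_commute (Algebra.commutes _ _).symm,
    ← NormedSpace.algebraMap_exp_comm, ← Real.exp_eq_exp_ℝ, Algebra.algebraMap_eq_smul_one,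
    mul_smul_comm, mul_one]

theorem hasSum_expSemigroup_apply {E : Type*} [NormedAddCommGroup E] [NormedSpace ℝ E]
    [CompleteSpace E] (A : E →L[ℝ] E) (t : ℝ) (f : E) :
    HasSum (fun n : ℕ => ((n.factorial : ℝ)⁻¹ * t ^ n) • (A ^ n) f) (expSemigroup A t f) := by
  have h := (NormedSpace.exp_series_hasSum_exp' (𝕂 := ℝ) (t • A)).mapL
    (ContinuousLinearMap.apply ℝ E f)
  have h2 : (fun n : ℕ => ((n.factorial : ℝ)⁻¹ * t ^ n) • (A ^ n) f)
      = fun n : ℕ => ContinuousLinearMap.apply ℝ E f ((n.factorial : ℝ)⁻¹ • (t • A) ^ n) := by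
    funext n
    rw [smul_pow, smul_smul]
    rfl
  rw [h2]
  exact h

/-- Uniformization: the total rate is a scalar, so it commutes and factors out of the exponential.
For nonnegative rates this leaves the power series of a positivity-preserving operator, which can be
bounded term by term. -/
theorem hasSum_semigroup_apply (lam κ γ : ℝ) (t : ℝ≥0) (f : State →ᵇ ℝ) (p : State) :
    HasSum (fun n : ℕ => Real.exp (-(lam + 2 * κ + γ) * t) *
        ((n.factorial : ℝ)⁻¹ * (t : ℝ) ^ n * (jumpOperator lam κ γ ^ n) f p))
      (semigroup lam κ γ t f p) := by
  rw [semigroup, generator_eq_jumpOperator_sub, expSemigroup_add_smul_one]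
  exact (((hasSum_expSemigroup_apply (jumpOperator lam κ γ) t f).mapL
    (BoundedContinuousFunction.evalCLM ℝ p)).mul_left _)

/-! ### Truncation of unbounded nonnegative eigenfunctions -/

/-- The restriction of a function to the positions `|x| ≤ N`, extended by zero. -/
noncomputable def truncate (φ : State → ℝ) (N : ℕ) : State →ᵇ ℝ :=
  BoundedContinuousFunction.ofNormedAddCommGroupDiscrete
    (fun p => if |p.1| ≤ N then φ p else 0)
    (∑ p ∈ Finset.Icc (-(N : ℤ)) N ×ˢ (Finset.univ : Finset ℤˣ), |φ p|)
    (fun p => by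
      split_ifs with h
      · refine Finset.single_le_sum (f := fun p => |φ p|) (fun _ _ => abs_nonneg _) ?_
        simpa only [Finset.mem_product, Finset.mem_univ, and_true, Finset.mem_Icc, abs_le] using h
      · simpa using Finset.sum_nonneg fun _ _ => abs_nonneg _)

theorem truncate_apply (φ : State → ℝ) (N : ℕ) (p : State) :
    truncate φ N p = if |p.1| ≤ N then φ p else 0 :=
  rfl

theorem truncate_nonneg {φ : State → ℝ} (hφ : ∀ p, 0 ≤ φ p) (N : ℕ) (p : State) :
    0 ≤ truncate φ N p := by
  rw [truncate_apply]; split_ifs; exacts [hφ p, le_rfl]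

theorem truncate_le {φ : State → ℝ} (hφ : ∀ p, 0 ≤ φ p) (N : ℕ) (p : State) :
    truncate φ N p ≤ φ p := by
  rw [truncate_apply]; split_ifs; exacts [le_rfl, hφ p]

theorem truncate_monotone {φ : State → ℝ} (hφ : ∀ p, 0 ≤ φ p) (p : State) :
    Monotone fun N => truncate φ N p := by
  intro M N hMN
  have : (M : ℤ) ≤ N := by exact_mod_cast hMN
  simp only [truncate_apply]
  split_ifs with h1 h2
  · exact le_rfl
  · exact absurd (h1.trans this) h2
  · exact hφ p
  · exact le_rfl

theorem eventually_truncate_eq (φ : State → ℝ) (p : State) :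
    ∀ᶠ N in atTop, truncate φ N p = φ p := by
  filter_upwards [eventually_ge_atTop p.1.natAbs] with N hN
  rw [truncate_apply, if_pos]
  rw [Int.abs_eq_natAbs]
  exact_mod_cast hN

section Eigenfunction

variable {lam κ γ Λ : ℝ} {φ : State → ℝ}

/-- The jump operator preserves order, so iterates of the truncation stay between 0 and the iterates
of φ itself. This supplies the dominating series. -/
theorem jumpOperator_pow_truncate_mem_Icc (hlam : 0 ≤ lam) (hκ : 0 ≤ κ) (hγ : 0 ≤ γ)
    (hφ : ∀ p, 0 ≤ φ p)
    (heig : ∀ x v, lam * φ (x + ((v : ℤˣ) : ℤ), v) + κ * (φ (x + 1, v) + φ (x - 1, v))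
      + γ * φ (x, -v) = Λ * φ (x, v)) (N n : ℕ) (p : State) :
    (jumpOperator lam κ γ ^ n) (truncate φ N) p ∈ Set.Icc 0 (Λ ^ n * φ p) := by
  induction n generalizing p with
  | zero => simpa using ⟨truncate_nonneg hφ N p, truncate_le hφ N p⟩
  | succ n ih =>
    obtain ⟨x, v⟩ := p
    rw [pow_succ' (jumpOperator lam κ γ), mul_apply_eq_comp, jumpOperator_apply]
    constructor
    · have h1 := (ih (x + (v : ℤ), v)).1
      have h2 := (ih (x + 1, v)).1
      have h3 := (ih (x - 1, v)).1
      have h4 := (ih (x, -v)).1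
      positivity
    · have h1 := mul_le_mul_of_nonneg_left (ih (x + (v : ℤ), v)).2 hlam
      have h2 := mul_le_mul_of_nonneg_left (add_le_add (ih (x + 1, v)).2 (ih (x - 1, v)).2) hκ
      have h4 := mul_le_mul_of_nonneg_left (ih (x, -v)).2 hγ
      refine (add_le_add (add_le_add h1 h2) h4).trans_eq ?_
      rw [pow_succ, mul_assoc, ← heig]
      ring

/-- Finite propagation: one application moves the position by at most 1, so n of them do not see a
cutoff at distance n or more. -/
theorem jumpOperator_pow_truncate_eq
    (heig : ∀ x v, lam * φ (x + ((v : ℤˣ) : ℤ), v) + κ * (φ (x + 1, v) + φ (x - 1, v))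
      + γ * φ (x, -v) = Λ * φ (x, v)) (N n : ℕ) (p : State) (hp : |p.1| + n ≤ N) :
    (jumpOperator lam κ γ ^ n) (truncate φ N) p = Λ ^ n * φ p := by
  induction n generalizing p with
  | zero =>
    rw [pow_zero, one_apply_eq_self, truncate_apply, if_pos (by simpa using hp)]
    simp
  | succ n ih =>
    obtain ⟨x, v⟩ := p
    push_cast at hp
    rw [pow_succ', mul_apply_eq_comp, jumpOperator_apply, ih (x + (v : ℤ), v),
      ih (x + 1, v), ih (x - 1, v), ih (x, -v), pow_succ, mul_assoc, ← heig]
    · ring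
    all_goals simp only [] at hp ⊢
    · grind
    · grind
    · grind
    · rcases Int.units_eq_one_or v with rfl | rfl <;> simp <;> grind

/-- Each term of the Poisson series is eventually constant in N and is dominated by the matching
term of the exponential series of Λ t. -/
theorem tendsto_semigroup_truncate (hlam : 0 ≤ lam) (hκ : 0 ≤ κ) (hγ : 0 ≤ γ)
    (hφ : ∀ p, 0 ≤ φ p)
    (heig : ∀ x v, lam * φ (x + ((v : ℤˣ) : ℤ), v) + κ * (φ (x + 1, v) + φ (x - 1, v))
      + γ * φ (x, -v) = Λ * φ (x, v)) (t : ℝ≥0) (p : State) :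
    Tendsto (fun N => semigroup lam κ γ t (truncate φ N) p) atTop
      (𝓝 (Real.exp ((Λ - (lam + 2 * κ + γ)) * t) * φ p)) := by
  set c := lam + 2 * κ + γ
  have hsum : HasSum (fun n : ℕ => Real.exp (-c * t) *
      ((n.factorial : ℝ)⁻¹ * (t : ℝ) ^ n * (Λ ^ n * φ p))) (Real.exp ((Λ - c) * t) * φ p) := by
    have h := NormedSpace.expSeries_div_hasSum_exp (Λ * (t : ℝ))
    rw [← Real.exp_eq_exp_ℝ] at h
    have h2 := (h.mul_right (φ p)).mul_left (Real.exp (-c * t))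
    rw [← mul_assoc, ← Real.exp_add] at h2
    have h3 : -c * t + Λ * t = (Λ - c) * t := by ring
    rw [h3] at h2
    refine (congrArg (HasSum · _) (funext fun n => ?_)).mp h2
    rw [mul_pow]
    field_simp
  rw [← hsum.tsum_eq]
  simp_rw [← (hasSum_semigroup_apply lam κ γ t (truncate φ _) p).tsum_eq]
  refine tendsto_tsum_of_dominated_convergence hsum.summable (fun n => ?_)
    (Eventually.of_forall fun N n => ?_)
  · refine tendsto_const_nhds.congr' ?_
    filter_upwards [eventually_ge_atTop (p.1.natAbs + n)] with N hN
    rw [jumpOperator_pow_truncate_eq heig]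
    rw [Int.abs_eq_natAbs]
    exact_mod_cast hN
  · have h := jumpOperator_pow_truncate_mem_Icc hlam hκ hγ hφ heig N n p
    rw [Real.norm_of_nonneg (by have := h.1; positivity)]
    gcongr
    exact h.2

end Eigenfunction

/-! ### Exponential moments -/

instance : MeasurableSingletonClass ℤˣ where
  measurableSet_singleton v := by
    have h : ({v} : Set ℤˣ) = Units.val ⁻¹' {(v : ℤ)} := by
      ext u
      exact Units.val_inj.symm
    rw [h]
    exact ⟨_, measurableSet_singleton _, rfl⟩

section Moments

variable {Ω : Type*} [mΩ : MeasurableSpace Ω] {μ : Measure Ω} [IsProbabilityMeasure μ]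
  {ℱ : Filtration ℝ≥0 mΩ} {X : ℝ≥0 → Ω → ℤ} {V : ℝ≥0 → Ω → ℤˣ} {lam κ γ : ℝ}

/-- The Markov property from time 0, integrated by the tower property. -/
theorem IsRunAndTumble.integral_eq (h : IsRunAndTumble lam κ γ ℱ X V μ) (t : ℝ≥0)
    (f : State →ᵇ ℝ) :
    ∫ ω, f (X t ω, V t ω) ∂μ = ∫ ω, semigroup lam κ γ t f (0, V 0 ω) ∂μ := by
  have h1 := h.markov 0 t f
  rw [zero_add] at h1
  rw [← integral_condExp (ℱ.le 0), integral_congr_ae h1]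
  refine integral_congr_ae ?_
  filter_upwards [h.position_zero] with ω hω
  rw [hω]

omit [IsProbabilityMeasure μ] in
theorem IsRunAndTumble.measurable_state (h : IsRunAndTumble lam κ γ ℱ X V μ) (t : ℝ≥0) :
    Measurable fun ω => (X t ω, V t ω) :=
  (((h.measurable_position t).mono (ℱ.le t) le_rfl).prodMk
    ((h.measurable_velocity t).mono (ℱ.le t) le_rfl))

/-- The expectation of a nonnegative eigenfunction of the generator grows exponentially. -/
theorem IsRunAndTumble.lintegral_eigenfunction (h : IsRunAndTumble lam κ γ ℱ X V μ)
    (hlam : 0 ≤ lam) (hκ : 0 ≤ κ) (hγ : 0 ≤ γ) {φ : State → ℝ} {Λ : ℝ} (hφ : ∀ p, 0 ≤ φ p)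
    (heig : ∀ x v, lam * φ (x + ((v : ℤˣ) : ℤ), v) + κ * (φ (x + 1, v) + φ (x - 1, v))
      + γ * φ (x, -v) = Λ * φ (x, v)) (t : ℝ≥0) :
    ∫⁻ ω, ENNReal.ofReal (φ (X t ω, V t ω)) ∂μ
      = ENNReal.ofReal (Real.exp ((Λ - (lam + 2 * κ + γ)) * t) * ∫ ω, φ (0, V 0 ω) ∂μ) := by
  have hm := h.measurable_state
  have hlim1 : Tendsto (fun N => ∫⁻ ω, ENNReal.ofReal (truncate φ N (X t ω, V t ω)) ∂μ) atTop
      (𝓝 (∫⁻ ω, ENNReal.ofReal (φ (X t ω, V t ω)) ∂μ)) := by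
    refine lintegral_tendsto_of_tendsto_of_monotone (fun N => ?_) (ae_of_all _ fun ω => ?_)
      (ae_of_all _ fun ω => ?_)
    · exact ((measurable_of_countable _).comp (hm t)).ennreal_ofReal.aemeasurable
    · exact fun M N hMN => ENNReal.ofReal_le_ofReal (truncate_monotone hφ _ hMN)
    · refine tendsto_const_nhds.congr' ?_
      filter_upwards [eventually_truncate_eq φ (X t ω, V t ω)] with N hN
      rw [hN]
  have hint : ∀ N, ∫⁻ ω, ENNReal.ofReal (truncate φ N (X t ω, V t ω)) ∂μ
      = ENNReal.ofReal (∫ ω, semigroup lam κ γ t (truncate φ N) (0, V 0 ω) ∂μ) := by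
    intro N
    rw [← h.integral_eq, ofReal_integral_eq_lintegral_ofReal]
    · exact Integrable.of_bound
        ((measurable_of_countable (truncate φ N)).comp (hm t)).aestronglyMeasurable
        ‖truncate φ N‖ (ae_of_all _ fun ω => (truncate φ N).norm_coe_le_norm _)
    · exact ae_of_all _ fun ω => truncate_nonneg hφ N _
  -- The initial velocity has two values, so the limit in N passes through a finite sum and needs no
  -- further domination.
  have hfin : ∀ g : ℤˣ → ℝ, ∫ ω, g (V 0 ω) ∂μ = ∑ v, (μ.map (V 0)).real {v} * g v := by
    intro g
    have hV : Measurable (V 0) := measurable_snd.comp (hm 0)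
    have := Measure.isProbabilityMeasure_map (μ := μ) hV.aemeasurable
    rw [← integral_map (f := g) hV.aemeasurable
      (measurable_of_countable g).aestronglyMeasurable, integral_fintype Integrable.of_finite]
    rfl
  have hlim2 : Tendsto (fun N => ∫ ω, semigroup lam κ γ t (truncate φ N) (0, V 0 ω) ∂μ) atTop
      (𝓝 (Real.exp ((Λ - (lam + 2 * κ + γ)) * t) * ∫ ω, φ (0, V 0 ω) ∂μ)) := by
    rw [← integral_const_mul,
      hfin fun v => Real.exp ((Λ - (lam + 2 * κ + γ)) * t) * φ (0, v)]
    simp_rw [fun N => hfin fun v => semigroup lam κ γ t (truncate φ N) (0, v)]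
    exact tendsto_finsetSum _ fun v _ =>
      (tendsto_semigroup_truncate hlam hκ hγ hφ heig t (0, v)).const_mul _
  simp_rw [hint] at hlim1
  exact tendsto_nhds_unique hlim1 (ENNReal.tendsto_ofReal hlim2)

end Moments
-- Two-sided moment bounds from the Perron eigenfunction
/-- The exponential moments of `Y_t` agree with `exp (t F)` up to constants. -/
def ExpMomentBounds {Ω : Type*} [MeasurableSpace Ω] (μ : Measure Ω) (Y : ℝ≥0 → Ω → ℝ)
    (F : ℝ → ℝ) : Prop :=
  ∀ α, ∃ c C : ℝ, 0 < c ∧ 0 < C ∧ ∀ t : ℝ≥0,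
    Integrable (fun ω => Real.exp (α * Y t ω)) μ ∧
    c * Real.exp (F α * t) ≤ ∫ ω, Real.exp (α * Y t ω) ∂μ ∧
    ∫ ω, Real.exp (α * Y t ω) ∂μ ≤ C * Real.exp (F α * t)

/-- The Perron eigenvector of the velocity matrix. -/
noncomputable def perronVector (lam γ α : ℝ) (v : ℤˣ) : ℝ :=
  if v = 1 then γ else √(γ ^ 2 + lam ^ 2 * Real.sinh α ^ 2) - lam * Real.sinh α

theorem abs_lt_sqrt_add_sq {γ : ℝ} (hγ : 0 < γ) (lam α : ℝ) :
    |lam * Real.sinh α| < √(γ ^ 2 + lam ^ 2 * Real.sinh α ^ 2) := by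
  refine Real.lt_sqrt_of_sq_lt ?_
  rw [sq_abs, mul_pow]
  linarith [pow_pos hγ 2]

theorem perronVector_pos {γ : ℝ} (hγ : 0 < γ) (lam α : ℝ) (v : ℤˣ) :
    0 < perronVector lam γ α v := by
  unfold perronVector
  split_ifs
  · exact hγ
  · linarith [abs_lt_sqrt_add_sq hγ lam α, le_abs_self (lam * Real.sinh α)]

/-- After `exp (α * x)` is factored out, the row v = 1 holds by the choice of the vector, and the
row v = -1 is the characteristic equation, that is, the square of the root `hs`. The total rate is
added since the jump operator is the generator plus that rate. -/
theorem perronVector_eigenfunction (lam κ γ α : ℝ) (x : ℤ) (v : ℤˣ) :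
    lam * (Real.exp (α * ((x + (v : ℤ) : ℤ) : ℝ)) * perronVector lam γ α v)
      + κ * (Real.exp (α * ((x + 1 : ℤ) : ℝ)) * perronVector lam γ α v
        + Real.exp (α * ((x - 1 : ℤ) : ℝ)) * perronVector lam γ α v)
      + γ * (Real.exp (α * x) * perronVector lam γ α (-v))
    = (freeEnergy lam κ γ α + (lam + 2 * κ + γ))
        * (Real.exp (α * x) * perronVector lam γ α v) := by
  have hs : √(γ ^ 2 + lam ^ 2 * Real.sinh α ^ 2) ^ 2 = γ ^ 2 + lam ^ 2 * Real.sinh α ^ 2 :=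
    Real.sq_sqrt (by positivity)
  have h1 : Real.exp (α * ((x + 1 : ℤ) : ℝ))
      = Real.exp (α * x) * (Real.cosh α + Real.sinh α) := by
    rw [Real.cosh_add_sinh, ← Real.exp_add]; push_cast; ring_nf
  have h2 : Real.exp (α * ((x - 1 : ℤ) : ℝ))
      = Real.exp (α * x) * (Real.cosh α - Real.sinh α) := by
    rw [Real.cosh_sub_sinh, ← Real.exp_add]; push_cast; ring_nf
  unfold freeEnergy
  rcases Int.units_eq_one_or v with rfl | rfl
  · simp only [Units.val_one, perronVector, h1, h2, if_true, if_neg (show (-1 : ℤˣ) ≠ 1 by decide)]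
    ring
  · rw [Units.val_neg, Units.val_one, ← sub_eq_add_neg, neg_neg]
    simp only [perronVector, h1, h2, if_true, if_neg (show (-1 : ℤˣ) ≠ 1 by decide)]
    linear_combination (-Real.exp (α * x)) * hs

theorem IsRunAndTumble.expMomentBounds {Ω : Type*} [mΩ : MeasurableSpace Ω] {μ : Measure Ω}
    [IsProbabilityMeasure μ] {ℱ : Filtration ℝ≥0 mΩ} {X : ℝ≥0 → Ω → ℤ} {V : ℝ≥0 → Ω → ℤˣ}
    {lam κ γ : ℝ} (h : IsRunAndTumble lam κ γ ℱ X V μ) (hlam : 0 ≤ lam) (hκ : 0 ≤ κ)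
    (hγ : 0 < γ) : ExpMomentBounds μ (fun t ω => (X t ω : ℝ)) (freeEnergy lam κ γ) := by
  intro α
  set g := perronVector lam γ α
  set m := min (g 1) (g (-1))
  set M := max (g 1) (g (-1))
  have hm : 0 < m := lt_min (perronVector_pos hγ _ _ _) (perronVector_pos hγ _ _ _)
  have hM : 0 < M := lt_max_of_lt_left (perronVector_pos hγ _ _ _)
  have hmg : ∀ v, m ≤ g v := fun v => by
    rcases Int.units_eq_one_or v with rfl | rfl
    exacts [min_le_left _ _, min_le_right _ _]
  have hgM : ∀ v, g v ≤ M := fun v => by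
    rcases Int.units_eq_one_or v with rfl | rfl
    exacts [le_max_left _ _, le_max_right _ _]
  -- The velocity factor lies in [m, M] both at time t and at time 0; each of the two comparisons
  -- contributes one of m, M to each constant.
  refine ⟨m / M, M / m, by positivity, by positivity, fun t => ?_⟩
  set F := freeEnergy lam κ γ α
  have hmeas := h.measurable_state
  let φ : State → ℝ := fun p => Real.exp (α * (p.1 : ℝ)) * g p.2
  have hφ : ∀ p, 0 ≤ φ p := fun p => by have := hm.trans_le (hmg p.2); positivity
  have hl := h.lintegral_eigenfunction hlam hκ hγ.le hφ
    (fun x v => perronVector_eigenfunction lam κ γ α x v) t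
  rw [add_sub_cancel_right] at hl
  have hφm : AEStronglyMeasurable (fun ω => φ (X t ω, V t ω)) μ :=
    ((measurable_of_countable φ).comp (hmeas t)).aestronglyMeasurable
  have hφi : Integrable (fun ω => φ (X t ω, V t ω)) μ := by
    refine ⟨hφm, ?_⟩
    rw [hasFiniteIntegral_iff_ofReal (ae_of_all _ fun ω => hφ _), hl]
    exact ENNReal.ofReal_lt_top
  have h0i : Integrable (fun ω => φ (0, V 0 ω)) μ := by
    refine Integrable.of_bound ((measurable_of_countable fun v => φ (0, v)).comp
      (measurable_snd.comp (hmeas 0))).aestronglyMeasurable M (ae_of_all _ fun ω => ?_)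
    rw [Real.norm_of_nonneg (hφ _)]
    simpa [φ] using hgM _
  have h0m : m ≤ ∫ ω, φ (0, V 0 ω) ∂μ := by
    simpa using integral_mono (integrable_const m) h0i
      (fun ω => by simpa [φ] using hmg (V 0 ω))
  have h0M : ∫ ω, φ (0, V 0 ω) ∂μ ≤ M := by
    simpa using integral_mono h0i (integrable_const M)
      (fun ω => by simpa [φ] using hgM (V 0 ω))
  have hφint : ∫ ω, φ (X t ω, V t ω) ∂μ = Real.exp (F * t) * ∫ ω, φ (0, V 0 ω) ∂μ := by
    rw [integral_eq_lintegral_of_nonneg_ae (ae_of_all _ fun ω => hφ _) hφm, hl,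
      ENNReal.toReal_ofReal (mul_nonneg (Real.exp_nonneg _) (hm.le.trans h0m))]
  have hle : ∀ ω, m * Real.exp (α * (X t ω : ℝ)) ≤ φ (X t ω, V t ω) := fun ω => by
    simp only [φ]
    rw [mul_comm]
    gcongr
    exact hmg _
  have hge : ∀ ω, φ (X t ω, V t ω) ≤ M * Real.exp (α * (X t ω : ℝ)) := fun ω => by
    simp only [φ]
    rw [mul_comm]
    gcongr
    exact hgM _
  have hXi : Integrable (fun ω => Real.exp (α * (X t ω : ℝ))) μ := by
    refine (hφi.const_mul m⁻¹).mono'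
      ((measurable_of_countable fun p : State => Real.exp (α * (p.1 : ℝ))).comp
        (hmeas t)).aestronglyMeasurable (ae_of_all _ fun ω => ?_)
    rw [Real.norm_of_nonneg (Real.exp_nonneg _), le_inv_mul_iff₀ hm]
    exact hle ω
  have hi1 := integral_mono (hXi.const_mul m) hφi hle
  have hi2 := integral_mono hφi (hXi.const_mul M) hge
  rw [integral_const_mul, hφint] at hi1
  rw [integral_const_mul, hφint] at hi2
  refine ⟨hXi, ?_, ?_⟩
  · rw [div_mul_eq_mul_div, div_le_iff₀' hM]
    refine le_trans ?_ hi2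
    rw [mul_comm]
    gcongr
  · rw [div_mul_eq_mul_div, le_div_iff₀' hm]
    refine hi1.trans ?_
    rw [mul_comm M]
    gcongr

/-! ### The free energy and the Fourier matrix -/

theorem ExpMomentBounds.tendsto_log {Ω : Type*} [MeasurableSpace Ω] {μ : Measure Ω}
    {Y : ℝ≥0 → Ω → ℝ} {F : ℝ → ℝ} (h : ExpMomentBounds μ Y F) (α : ℝ) :
    Tendsto (fun t : ℝ≥0 => 1 / (t : ℝ) * Real.log (∫ ω, Real.exp (α * Y t ω) ∂μ)) atTop
      (𝓝 (F α)) := by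
  obtain ⟨c, C, hc, hC, h⟩ := h α
  have hlim : ∀ K : ℝ, Tendsto (fun t : ℝ≥0 => 1 / (t : ℝ) * K + F α) atTop (𝓝 (F α)) := by
    intro K
    have h1 : Tendsto (fun t : ℝ≥0 => 1 / (t : ℝ)) atTop (𝓝 0) := by
      simpa [Pi.inv_def] using (NNReal.tendsto_coe_atTop.2 tendsto_id).inv_tendsto_atTop
    simpa using (h1.mul_const K).add_const (F α)
  refine tendsto_of_tendsto_of_tendsto_of_le_of_le' (hlim (Real.log c)) (hlim (Real.log C)) ?_ ?_
  all_goals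
    filter_upwards [eventually_gt_atTop 0] with t ht
    have ht : (0 : ℝ) < t := ht
    obtain ⟨-, h1, h2⟩ := h t
  · have h3 := Real.log_le_log (by positivity) h1
    rw [Real.log_mul hc.ne' (Real.exp_ne_zero _), Real.log_exp] at h3
    calc _ = 1 / (t : ℝ) * (Real.log c + F α * t) := by field_simp
      _ ≤ _ := by gcongr
  · have h3 := Real.log_le_log (lt_of_lt_of_le (by positivity) h1) h2
    rw [Real.log_mul hC.ne' (Real.exp_ne_zero _), Real.log_exp] at h3
    calc _ ≤ 1 / (t : ℝ) * (Real.log C + F α * t) := by gcongr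
      _ = _ := by field_simp

/-- At q = -iα, cos q = cosh α and i sin q = sinh α, so the matrix becomes real symmetric. -/
theorem fourierMatrix_neg_I_mul (lam κ γ α : ℝ) :
    fourierMatrix lam κ γ (-Complex.I * (α : ℂ))
      = (!![(2 * κ + lam) * (Real.cosh α - 1) - γ + lam * Real.sinh α, γ;
          γ, (2 * κ + lam) * (Real.cosh α - 1) - γ - lam * Real.sinh α] :
            Matrix (Fin 2) (Fin 2) ℝ).map (algebraMap ℝ ℂ) := by
  have hc : Complex.cos (-Complex.I * α) = Complex.cosh α := by
    rw [neg_mul, Complex.cos_neg, mul_comm, Complex.cos_mul_I]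
  have hs : Complex.sin (-Complex.I * α) = -(Complex.sinh α * Complex.I) := by
    rw [neg_mul, Complex.sin_neg, mul_comm, Complex.sin_mul_I]
  have hI : Complex.I * lam * -(Complex.sinh α * Complex.I) = lam * Complex.sinh α := by
    linear_combination (-(lam * Complex.sinh α)) * Complex.I_mul_I
  ext i j
  rw [fourierMatrix, hc, hs]
  fin_cases i <;> fin_cases j
  · simpa using hI
  · simp
  · simp
  · simpa [sub_eq_add_neg, neg_eq_iff_eq_neg] using hI

theorem hasEigenvalue_fourierMatrix {γ : ℝ} (hγ : 0 < γ) (lam κ α : ℝ) :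
    Module.End.HasEigenvalue
      (Matrix.toLin' (fourierMatrix lam κ γ (-Complex.I * (α : ℂ))))
      ((freeEnergy lam κ γ α : ℝ) : ℂ) := by
  have hs : √(γ ^ 2 + lam ^ 2 * Real.sinh α ^ 2) ^ 2 = γ ^ 2 + lam ^ 2 * Real.sinh α ^ 2 :=
    Real.sq_sqrt (by positivity)
  refine Module.End.hasEigenvalue_of_hasEigenvector
    -- The same entries as `perronVector`; the vector is nonzero because its first entry is γ.
    (x := fun i => (((![γ, √(γ ^ 2 + lam ^ 2 * Real.sinh α ^ 2) - lam * Real.sinh α] :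
      Fin 2 → ℝ) i : ℝ) : ℂ)) ⟨?_, fun h => ?_⟩
  · rw [Module.End.mem_eigenspace_iff, Matrix.toLin'_apply, fourierMatrix_neg_I_mul]
    ext i
    fin_cases i
    · simp only [Matrix.mulVec, dotProduct, Fin.sum_univ_two, Matrix.map_apply, Pi.smul_apply,
        smul_eq_mul, Complex.coe_algebraMap]
      norm_cast
      simp [freeEnergy]
      ring
    · simp only [Matrix.mulVec, dotProduct, Fin.sum_univ_two, Matrix.map_apply, Pi.smul_apply,
        smul_eq_mul, Complex.coe_algebraMap]
      norm_cast
      simp [freeEnergy]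
      linear_combination -hs
  · have := congrFun h 0
    simp at this
    exact hγ.ne' this

theorem eigenvalue_fourierMatrix_le {γ : ℝ} (hγ : 0 < γ) (lam κ α : ℝ) (z : ℂ)
    (hz : Module.End.HasEigenvalue
      (Matrix.toLin' (fourierMatrix lam κ γ (-Complex.I * (α : ℂ)))) z) :
    z.im = 0 ∧ z.re ≤ freeEnergy lam κ γ α := by
  obtain ⟨w, hw, hw0⟩ := hz.exists_hasEigenvector
  rw [Module.End.mem_eigenspace_iff, Matrix.toLin'_apply, fourierMatrix_neg_I_mul] at hw
  have e0 := congrFun hw 0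
  have e1 := congrFun hw 1
  set s := √(γ ^ 2 + lam ^ 2 * Real.sinh α ^ 2) with hsdef
  have hs : (s : ℂ) ^ 2 = γ ^ 2 + lam ^ 2 * Real.sinh α ^ 2 := by
    exact_mod_cast Real.sq_sqrt (show 0 ≤ γ ^ 2 + lam ^ 2 * Real.sinh α ^ 2 by positivity)
  set d := (2 * κ + lam) * (Real.cosh α - 1) - γ with hd
  simp only [Matrix.mulVec, dotProduct, Fin.sum_univ_two, Matrix.map_apply, Pi.smul_apply,
        smul_eq_mul, Complex.coe_algebraMap] at e0 e1
  simp at e0 e1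
  have hγ' : (γ : ℂ) ≠ 0 := by exact_mod_cast hγ.ne'
  have hfac : (z - (d + s : ℝ)) * (z - (d - s : ℝ)) = 0 := by
    -- The off-diagonal entry γ is nonzero, so the first row would make an eigenvector with `w 0 =
    -- 0` vanish. Eliminating `w 1` then gives the characteristic polynomial times `w 0`.
    have hw00 : w 0 ≠ 0 := by
      intro h0
      apply hw0
      ext i
      fin_cases i
      · exact h0
      · rw [h0] at e0
        simpa [hγ'] using e0
    refine (mul_eq_zero.1 ?_).resolve_right hw00
    rw [Complex.ofReal_sinh] at hs
    push_cast
    linear_combination (-(z - d + lam * Complex.sinh α)) * e0 - γ * e1 - w 0 * hs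
  have hF : freeEnergy lam κ γ α = d + s := by unfold freeEnergy; ring
  rw [hF]
  rcases mul_eq_zero.1 hfac with h | h <;> rw [sub_eq_zero.1 h]
  · exact ⟨Complex.ofReal_im _, (Complex.ofReal_re _).le⟩
  · refine ⟨Complex.ofReal_im _, ?_⟩
    rw [Complex.ofReal_re]
    linarith [Real.sqrt_nonneg (γ ^ 2 + lam ^ 2 * Real.sinh α ^ 2)]

/-! ### Large deviations from bounds on exponential moments -/

section LDP

variable {Ω : Type*} [MeasurableSpace Ω] {μ : Measure Ω} [IsProbabilityMeasure μ]
  {Y : ℝ≥0 → Ω → ℝ} {F : ℝ → ℝ}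

/-- Constant prefactors disappear at exponential scale, which is why moment bounds up to constants
suffice. -/
theorem tendsto_log_const_mul_exp {C : ℝ} (hC : 0 < C) (r : ℝ) :
    Tendsto (fun t : ℝ≥0 => ((1 / (t : ℝ) : ℝ) : EReal)
      * ENNReal.log (ENNReal.ofReal (C * Real.exp (-r * t)))) atTop (𝓝 ((-r : ℝ) : EReal)) := by
  have h1 : Tendsto (fun t : ℝ≥0 => 1 / (t : ℝ)) atTop (𝓝 0) := by
    simpa [Pi.inv_def] using (NNReal.tendsto_coe_atTop.2 tendsto_id).inv_tendsto_atTop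
  have h2 : Tendsto (fun t : ℝ≥0 => 1 / (t : ℝ) * Real.log C + -r) atTop (𝓝 (-r)) := by
    simpa using (h1.mul_const (Real.log C)).add_const (-r)
  refine ((continuous_coe_real_ereal.tendsto _).comp h2).congr' ?_
  filter_upwards [eventually_gt_atTop 0] with t ht
  have ht : (0 : ℝ) < t := ht
  rw [ENNReal.log_ofReal_of_pos (by positivity), Real.log_mul hC.ne' (Real.exp_ne_zero _),
    Real.log_exp, ← EReal.coe_mul, Function.comp_apply]
  congr 1
  field_simp

theorem limsup_log_measure_le {s : ℝ≥0 → Set Ω} {C r : ℝ} (hC : 0 < C)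
    (h : ∀ᶠ t : ℝ≥0 in atTop, μ.real (s t) ≤ C * Real.exp (-r * t)) :
    limsup (fun t : ℝ≥0 => ((1 / (t : ℝ) : ℝ) : EReal) * ENNReal.log (μ (s t))) atTop
      ≤ ((-r : ℝ) : EReal) := by
  rw [← (tendsto_log_const_mul_exp hC r).limsup_eq]
  refine limsup_le_limsup ?_
  filter_upwards [h] with t ht
  refine mul_le_mul_of_nonneg_left (ENNReal.log_le_log ?_) (by simp)
  rw [← ofReal_measureReal]
  exact ENNReal.ofReal_le_ofReal ht

theorem le_liminf_log_measure {s : ℝ≥0 → Set Ω} {c r : ℝ} (hc : 0 < c)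
    (h : ∀ᶠ t : ℝ≥0 in atTop, c * Real.exp (-r * t) ≤ μ.real (s t)) :
    ((-r : ℝ) : EReal)
      ≤ liminf (fun t : ℝ≥0 => ((1 / (t : ℝ) : ℝ) : EReal) * ENNReal.log (μ (s t))) atTop := by
  rw [← (tendsto_log_const_mul_exp hc r).liminf_eq]
  refine liminf_le_liminf ?_
  filter_upwards [h] with t ht
  refine mul_le_mul_of_nonneg_left (ENNReal.log_le_log ?_) (by simp)
  rw [← ofReal_measureReal]
  exact ENNReal.ofReal_le_ofReal ht

theorem legendre_nonneg (h0 : F 0 = 0) (x : ℝ) : 0 ≤ legendre F x := by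
  refine le_iSup_of_le 0 ?_
  simp [h0]

theorem lowerSemicontinuous_legendre : LowerSemicontinuous (legendre F) := by
  refine lowerSemicontinuous_iSup fun α => Continuous.lowerSemicontinuous ?_
  exact continuous_coe_real_ereal.comp (by fun_prop)

/-- Exponential Chernoff bound on a right half-line. -/
theorem ExpMomentBounds.exists_measureReal_ge_le (h : ExpMomentBounds μ Y F) (h0 : F 0 = 0)
    (hF : ∀ α, 0 ≤ F α) {b r : ℝ} (hb : 0 ≤ b) (hr : (r : EReal) < legendre F b) :
    ∃ C : ℝ, 0 < C ∧ ∀ t : ℝ≥0, 0 < t →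
      μ.real {ω | b ≤ Y t ω / t} ≤ C * Real.exp (-r * t) := by
  obtain ⟨α, hα, hrα⟩ : ∃ α : ℝ, 0 ≤ α ∧ r < α * b - F α := by
    obtain ⟨α, hα⟩ := lt_iSup_iff.1 hr
    rw [EReal.coe_lt_coe_iff] at hα
    rcases le_or_gt 0 α with h1 | h1
    · exact ⟨α, h1, hα⟩
    -- A negative tilt gives α b - F α ≤ 0 because b ≥ 0 and F ≥ 0, so the tilt 0 does at least as
    -- well.
    · exact ⟨0, le_rfl, by nlinarith [hF α]⟩
  obtain ⟨c, C, -, hC, hm⟩ := h α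
  refine ⟨C, hC, fun t ht => ?_⟩
  have ht : (0 : ℝ) < t := ht
  obtain ⟨hi, -, hle⟩ := hm t
  have hcher := measure_ge_le_exp_mul_mgf (b * t) hα hi
  have hset : {ω | b ≤ Y t ω / t} = {ω | b * t ≤ Y t ω} := by
    ext ω
    exact le_div_iff₀ ht
  rw [hset]
  calc _ ≤ Real.exp (-α * (b * t)) * (C * Real.exp (F α * t)) := by
        refine hcher.trans ?_
        gcongr
        exact hle
    _ = C * Real.exp (-(α * b - F α) * t) := by
        rw [mul_left_comm, ← Real.exp_add]
        ring_nf
    _ ≤ _ := by gcongr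

omit [IsProbabilityMeasure μ] in
theorem ExpMomentBounds.neg (h : ExpMomentBounds μ Y F) :
    ExpMomentBounds μ (fun t ω => -Y t ω) (fun α => F (-α)) := by
  intro α
  simpa using h (-α)

theorem legendre_comp_neg (F : ℝ → ℝ) (x : ℝ) :
    legendre (fun α => F (-α)) x = legendre F (-x) := by
  refine (Equiv.neg ℝ).iSup_congr fun α => ?_
  simp

/-- The reflection Y ↦ -Y reduces this to the right half-line. -/
theorem ExpMomentBounds.exists_measureReal_le_le (h : ExpMomentBounds μ Y F) (h0 : F 0 = 0)
    (hF : ∀ α, 0 ≤ F α) {b r : ℝ} (hb : b ≤ 0) (hr : (r : EReal) < legendre F b) :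
    ∃ C : ℝ, 0 < C ∧ ∀ t : ℝ≥0, 0 < t →
      μ.real {ω | Y t ω / t ≤ b} ≤ C * Real.exp (-r * t) := by
  have := h.neg.exists_measureReal_ge_le (b := -b) (r := r) (by simpa using h0)
    (fun α => hF _) (by linarith) (by rwa [legendre_comp_neg, neg_neg])
  simpa only [neg_div, neg_le_neg_iff] using this

theorem ExpMomentBounds.ldp_upper_bound (h : ExpMomentBounds μ Y F) (h0 : F 0 = 0)
    (hF : ∀ α, 0 ≤ F α) {B : Set ℝ} (hB : IsClosed B) :
    limsup (fun t : ℝ≥0 => ((1 / (t : ℝ) : ℝ) : EReal) * ENNReal.log (μ {ω | Y t ω / t ∈ B}))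
      atTop ≤ -(⨅ x ∈ B, legendre F x) := by
  rw [EReal.le_neg]
  refine EReal.ge_of_forall_gt_iff_ge.1 fun r hr => ?_
  have hr' : ∀ x ∈ B, (r : EReal) < legendre F x := fun x hx =>
    hr.trans_le (iInf₂_le x hx)
  have hright : ∃ C : ℝ, 0 < C ∧ ∀ t : ℝ≥0, 0 < t →
      μ.real {ω | Y t ω / t ∈ B ∩ Set.Ici 0} ≤ C * Real.exp (-r * t) := by
    rcases (B ∩ Set.Ici 0).eq_empty_or_nonempty with he | hne
    · refine ⟨1, one_pos, fun t _ => ?_⟩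
      simp only [he, Set.mem_empty_iff_false, Set.ofPred_false, measureReal_empty]
      positivity
    · have hbdd : BddBelow (B ∩ Set.Ici 0) := ⟨0, fun x hx => hx.2⟩
      -- The least nonnegative point of B belongs to B by closedness, so its rate exceeds r, and the
      -- half-line to its right covers this part of B. No compactness or exponential tightness is
      -- needed.
      have hmem := (hB.inter isClosed_Ici).csInf_mem hne hbdd
      obtain ⟨C, hC, hb⟩ := h.exists_measureReal_ge_le h0 hF hmem.2 (hr' _ hmem.1)
      exact ⟨C, hC, fun t ht => (hb t ht).trans' <| measureReal_mono fun ω hω => csInf_le hbdd hω⟩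
  have hleft : ∃ C : ℝ, 0 < C ∧ ∀ t : ℝ≥0, 0 < t →
      μ.real {ω | Y t ω / t ∈ B ∩ Set.Iic 0} ≤ C * Real.exp (-r * t) := by
    rcases (B ∩ Set.Iic 0).eq_empty_or_nonempty with he | hne
    · refine ⟨1, one_pos, fun t _ => ?_⟩
      simp only [he, Set.mem_empty_iff_false, Set.ofPred_false, measureReal_empty]
      positivity
    · have hbdd : BddAbove (B ∩ Set.Iic 0) := ⟨0, fun x hx => hx.2⟩
      have hmem := (hB.inter isClosed_Iic).csSup_mem hne hbdd
      obtain ⟨C, hC, hb⟩ := h.exists_measureReal_le_le h0 hF hmem.2 (hr' _ hmem.1)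
      exact ⟨C, hC, fun t ht => (hb t ht).trans' <| measureReal_mono fun ω hω => le_csSup hbdd hω⟩
  obtain ⟨C₁, hC₁, h₁⟩ := hright
  obtain ⟨C₂, hC₂, h₂⟩ := hleft
  rw [EReal.le_neg, ← EReal.coe_neg]
  refine limsup_log_measure_le (add_pos hC₁ hC₂) ?_
  filter_upwards [eventually_gt_atTop 0] with t ht
  rw [add_mul]
  refine le_trans (le_trans (measureReal_mono fun ω hω => ?_) (measureReal_union_le _ _))
    (add_le_add (h₁ t ht) (h₂ t ht))
  rcases le_total 0 (Y t ω / t) with h3 | h3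
  exacts [Or.inl ⟨hω, h3⟩, Or.inr ⟨hω, h3⟩]

/-- Lower bound for the probability of a neighbourhood of the derivative `x` of `F` at `η`, by tilting. -/
theorem ExpMomentBounds.exists_le_measureReal (h : ExpMomentBounds μ Y F)
    (hY : ∀ t, Measurable (Y t)) {x η δ : ℝ} (hx : HasDerivAt F x η) (hδ : 0 < δ) :
    ∃ c : ℝ, 0 < c ∧ ∀ᶠ t : ℝ≥0 in atTop,
      c * Real.exp (-(η * x - F η + |η| * δ) * t) ≤ μ.real {ω | |Y t ω / t - x| < δ} := by
  -- First-order expansion of F at η with error at most aδ/2. Extra tilts by ±a thus show that the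
  -- η-tilted mass outside the δ-neighbourhood of x is smaller than the total by a factor of order
  -- exp(-aδt/2).
  obtain ⟨a, ha, hp, hn⟩ : ∃ a : ℝ, 0 < a ∧ F (η + a) - a * (x + δ) ≤ F η - a * δ / 2 ∧
      F (η - a) + a * (x - δ) ≤ F η - a * δ / 2 := by
    have h1 := (hasDerivAt_iff_isLittleO_nhds_zero.1 hx).def (half_pos hδ)
    obtain ⟨ε, hε, h2⟩ := Metric.eventually_nhds_iff.1 h1
    refine ⟨ε / 2, half_pos hε, ?_, ?_⟩
    · have h3 := h2 (y := ε / 2) (by simp [abs_of_pos hε, hε])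
      rw [Real.norm_eq_abs, Real.norm_eq_abs, abs_of_pos (half_pos hε), smul_eq_mul] at h3
      linarith [(abs_le.1 h3).2]
    · have h3 := h2 (y := -(ε / 2)) (by simp [abs_of_pos hε, hε])
      rw [Real.norm_eq_abs, Real.norm_eq_abs, abs_neg, abs_of_pos (half_pos hε), smul_eq_mul,
        ← sub_eq_add_neg] at h3
      linarith [(abs_le.1 h3).2]
  obtain ⟨c, _, hc, _, h0⟩ := h η
  obtain ⟨_, C₁, _, hC₁, h₁⟩ := h (η + a)
  obtain ⟨_, C₂, _, hC₂, h₂⟩ := h (η - a)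
  -- The other half of the lower moment constant absorbs the two tails for large t.
  refine ⟨c / 2, half_pos hc, ?_⟩
  have hsmall : ∀ᶠ t : ℝ≥0 in atTop,
      (C₁ + C₂) * Real.exp (-(a * δ / 2) * t) < c / 2 := by
    have hlim : Tendsto (fun t : ℝ≥0 => (C₁ + C₂) * Real.exp (-(a * δ / 2) * t)) atTop
        (𝓝 ((C₁ + C₂) * 0)) := by
      refine (Real.tendsto_exp_atBot.comp ?_).const_mul _
      exact (NNReal.tendsto_coe_atTop.2 tendsto_id).const_mul_atTop_of_neg
        (neg_neg_of_pos (by positivity))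
    rw [mul_zero] at hlim
    exact hlim.eventually_lt_const (half_pos hc)
  filter_upwards [hsmall, eventually_gt_atTop 0] with t hsm ht
  have ht : (0 : ℝ) < t := ht
  set A := {ω | |Y t ω / t - x| < δ}
  have hA : MeasurableSet A :=
    measurableSet_lt (((hY t).div_const _).sub_const x).abs measurable_const
  -- On the neighbourhood the tilt is bounded by its extreme value; off it, the extra tilt towards
  -- the side where Y lies dominates.
  have hpt : ∀ ω, Real.exp (η * Y t ω) ≤
      A.indicator (fun _ => Real.exp ((η * x + |η| * δ) * t)) ω
        + (Real.exp (-(a * (x + δ)) * t) * Real.exp ((η + a) * Y t ω)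
        + Real.exp (a * (x - δ) * t) * Real.exp ((η - a) * Y t ω)) := by
    intro ω
    by_cases hω : ω ∈ A
    · rw [Set.indicator_of_mem hω]
      refine le_add_of_le_of_nonneg (Real.exp_le_exp.2 ?_) (by positivity)
      have h3 : η * (Y t ω / t - x) ≤ |η| * δ :=
        (le_abs_self _).trans (by rw [abs_mul]; gcongr; exact le_of_lt hω)
      have h4 : η * Y t ω = (η * (Y t ω / t)) * t := by field_simp
      rw [h4]
      gcongr
      linarith
    · rw [Set.indicator_of_notMem hω, zero_add, ← Real.exp_add, ← Real.exp_add]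
      have h3 : δ ≤ |Y t ω / t - x| := not_lt.1 hω
      have h4 : Y t ω = (Y t ω / t) * t := by field_simp
      rcases le_abs.1 h3 with h5 | h5
      · refine le_add_of_le_of_nonneg (Real.exp_le_exp.2 ?_) (by positivity)
        have : (x + δ) * t ≤ Y t ω := by
          rw [← le_div_iff₀ ht]; linarith
        nlinarith
      · refine le_add_of_nonneg_of_le (by positivity) (Real.exp_le_exp.2 ?_)
        have : Y t ω ≤ (x - δ) * t := by
          rw [← div_le_iff₀ ht]; linarith
        nlinarith
  have hiA : Integrable (A.indicator fun _ : Ω => Real.exp ((η * x + |η| * δ) * t)) μ :=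
    (integrable_const _).indicator hA
  have hi1 := (h₁ t).1.const_mul (Real.exp (-(a * (x + δ)) * t))
  have hi2 := (h₂ t).1.const_mul (Real.exp (a * (x - δ) * t))
  have hint := integral_mono (h0 t).1 (hiA.add (hi1.add hi2)) hpt
  rw [integral_add' hiA (hi1.add hi2), integral_add' hi1 hi2, integral_indicator_const _ hA,
    integral_const_mul, integral_const_mul, smul_eq_mul] at hint
  have hb1 : Real.exp (-(a * (x + δ)) * t) * ∫ ω, Real.exp ((η + a) * Y t ω) ∂μ
      ≤ C₁ * Real.exp (-(a * δ / 2) * t) * Real.exp (F η * t) := by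
    calc _ ≤ Real.exp (-(a * (x + δ)) * t) * (C₁ * Real.exp (F (η + a) * t)) := by
          gcongr
          exact (h₁ t).2.2
      _ = C₁ * Real.exp ((F (η + a) - a * (x + δ)) * t) := by
          rw [mul_left_comm, ← Real.exp_add]; ring_nf
      _ ≤ C₁ * Real.exp ((F η - a * δ / 2) * t) := by gcongr
      _ = _ := by rw [mul_assoc, ← Real.exp_add]; ring_nf
  have hb2 : Real.exp (a * (x - δ) * t) * ∫ ω, Real.exp ((η - a) * Y t ω) ∂μ
      ≤ C₂ * Real.exp (-(a * δ / 2) * t) * Real.exp (F η * t) := by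
    calc _ ≤ Real.exp (a * (x - δ) * t) * (C₂ * Real.exp (F (η - a) * t)) := by
          gcongr
          exact (h₂ t).2.2
      _ = C₂ * Real.exp ((F (η - a) + a * (x - δ)) * t) := by
          rw [mul_left_comm, ← Real.exp_add]; ring_nf
      _ ≤ C₂ * Real.exp ((F η - a * δ / 2) * t) := by gcongr
      _ = _ := by rw [mul_assoc, ← Real.exp_add]; ring_nf
  have hmain : c / 2 * Real.exp (F η * t)
      ≤ μ.real A * Real.exp ((η * x + |η| * δ) * t) := by
    have := mul_le_mul_of_nonneg_right hsm.le (Real.exp_nonneg (F η * t))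
    linarith [(h0 t).2.1]
  rw [← div_le_iff₀ (Real.exp_pos _), mul_div_assoc, ← Real.exp_sub] at hmain
  refine (le_of_eq ?_).trans hmain
  congr 2
  ring

/-- A large deviation principle for a process whose free energy `F` is such that every `x` either
has infinite rate or is the derivative of `F` at a point where the supremum is attained. -/
theorem ExpMomentBounds.satisfiesLDP (h : ExpMomentBounds μ Y F) (hY : ∀ t, Measurable (Y t))
    (h0 : F 0 = 0) (hF : ∀ α, 0 ≤ F α)
    (hatt : ∀ x, legendre F x = ⊤ ∨
      ∃ η, HasDerivAt F x η ∧ legendre F x = ((η * x - F η : ℝ) : EReal)) :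
    SatisfiesLDP μ (fun t ω => Y t ω / t) (legendre F) where
  nonneg := legendre_nonneg h0
  lowerSemicontinuous := lowerSemicontinuous_legendre
  upper_bound _ hB := h.ldp_upper_bound h0 hF hB
  lower_bound G hG := by
    rw [EReal.neg_le]
    refine le_iInf₂ fun x hxG => ?_
    rcases hatt x with htop | ⟨η, hη, hval⟩
    · rw [htop]; exact le_top
    rw [hval]
    refine EReal.le_of_forall_lt_iff_le.1 fun r hr => ?_
    rw [EReal.coe_lt_coe_iff] at hr
    obtain ⟨ε, hε, hball⟩ := Metric.isOpen_iff.1 hG x hxG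
    obtain ⟨δ, hδ, hδε, hδr⟩ : ∃ δ : ℝ, 0 < δ ∧ δ ≤ ε ∧ η * x - F η + |η| * δ ≤ r := by
      have hlt : ∀ᶠ δ in 𝓝[>] (0 : ℝ), η * x - F η + |η| * δ < r := by
        have hcont : Continuous fun δ : ℝ => η * x - F η + |η| * δ := by fun_prop
        exact (hcont.tendsto 0).eventually_lt_const (by simpa using hr) |>.filter_mono
          nhdsWithin_le_nhds
      obtain ⟨δ, h1, h2⟩ := (hlt.and (Ioc_mem_nhdsGT hε)).exists
      exact ⟨δ, h2.1, h2.2, h1.le⟩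
    obtain ⟨c, hc, hev⟩ := h.exists_le_measureReal hY hη hδ
    rw [EReal.neg_le, ← EReal.coe_neg]
    refine le_liminf_log_measure hc ?_
    filter_upwards [hev] with t ht
    refine le_trans ?_ (ht.trans (measureReal_mono fun ω hω => hball ?_))
    · gcongr
    · rw [Metric.mem_ball, Real.dist_eq]
      exact lt_of_lt_of_le hω hδε

end LDP

/-! ### Properties of the free energy -/

theorem freeEnergy_zero {γ : ℝ} (hγ : 0 < γ) (lam κ : ℝ) : freeEnergy lam κ γ 0 = 0 := by
  simp [freeEnergy, Real.sqrt_sq hγ.le]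

theorem le_freeEnergy (lam κ γ α : ℝ) :
    (2 * κ + lam) * (Real.cosh α - 1) ≤ freeEnergy lam κ γ α := by
  have : γ ≤ √(γ ^ 2 + lam ^ 2 * Real.sinh α ^ 2) :=
    Real.le_sqrt_of_sq_le (by nlinarith [sq_nonneg (lam * Real.sinh α)])
  unfold freeEnergy
  linarith

theorem differentiable_freeEnergy {γ : ℝ} (hγ : 0 < γ) (lam κ : ℝ) :
    Differentiable ℝ (freeEnergy lam κ γ) := by
  unfold freeEnergy
  intro α
  have h : γ ^ 2 + lam ^ 2 * Real.sinh α ^ 2 ≠ 0 :=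
    (add_pos_of_pos_of_nonneg (pow_pos hγ 2) (by positivity)).ne'
  fun_prop (disch := exact h)

/-- Half the sum of exp y ≥ 1 + y + y²/2 and exp(-y) ≥ 1 - y for y ≥ 0. The constant is not sharp;
only quadratic growth matters. -/
theorem sq_div_four_le_cosh_sub_one (α : ℝ) : α ^ 2 / 4 ≤ Real.cosh α - 1 := by
  have h : ∀ y : ℝ, 0 ≤ y → y ^ 2 / 4 ≤ Real.cosh y - 1 := fun y hy => by
    have h1 := Real.quadratic_le_exp_of_nonneg hy
    have h2 := Real.add_one_le_exp (-y)
    rw [Real.cosh_eq]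
    linarith
  rw [← Real.cosh_abs, ← sq_abs]
  exact h _ (abs_nonneg α)

theorem legendre_freeEnergy_eq_top_or {lam κ γ : ℝ} (hlam : 0 ≤ lam) (hκ : 0 ≤ κ) (hγ : 0 < γ)
    (x : ℝ) : legendre (freeEnergy lam κ γ) x = ⊤ ∨
      ∃ η, HasDerivAt (freeEnergy lam κ γ) x η ∧
        legendre (freeEnergy lam κ γ) x = ((η * x - freeEnergy lam κ γ η : ℝ) : EReal) := by
  set F := freeEnergy lam κ γ with hFdef
  have hd : Differentiable ℝ F := differentiable_freeEnergy hγ lam κ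
  -- A global maximizer is a critical point of α x - F α, which forces F'(η) = x.
  have hsuff : (∃ η, ∀ α, α * x - F α ≤ η * x - F η) → ∃ η, HasDerivAt F x η ∧
        legendre F x = ((η * x - F η : ℝ) : EReal) := by
    rintro ⟨η, hη⟩
    refine ⟨η, ?_, le_antisymm (iSup_le fun α => EReal.coe_le_coe_iff.2 (hη α))
      (le_iSup (fun α : ℝ => ((α * x - F α : ℝ) : EReal)) η)⟩
    have h1 : HasDerivAt (fun α => α * x - F α) (x - deriv F η) η := by
      simpa using ((hasDerivAt_id η).mul_const x).fun_sub (hd η).hasDerivAt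
    have h2 : IsLocalMax (fun α => α * x - F α) η := Eventually.of_forall hη
    have h3 := h2.hasDerivAt_eq_zero h1
    rw [sub_eq_zero.1 h3]
    exact (hd η).hasDerivAt
  set m := 2 * κ + lam with hm
  rcases (show 0 ≤ m by positivity).eq_or_lt with h0 | hpos
  -- Degenerate case without motion: the Legendre transform is 0 at the origin and infinite
  -- elsewhere.
  · have hF0 : ∀ α, F α = 0 := fun α => by
      have hl : lam = 0 := by linarith
      have hk : κ = 0 := by linarith
      simp [hFdef, freeEnergy, hl, hk, Real.sqrt_sq hγ.le]
    by_cases hx : x = 0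
    · exact Or.inr (hsuff ⟨0, fun α => by simp [hF0, hx]⟩)
    · left
      rw [EReal.eq_top_iff_forall_lt]
      intro y
      refine lt_of_lt_of_le (EReal.coe_lt_coe_iff.2 (lt_add_one y))
        (le_iSup_of_le ((y + 1) / x) (EReal.coe_le_coe_iff.2 ?_))
      rw [hF0, div_mul_cancel₀ _ hx, sub_zero]
  · refine Or.inr (hsuff ?_)
    -- Beyond R the bound F α ≥ m α²/4 exceeds |α||x|, so α x - F α falls below its value 0 at α = 0
    -- and the maximum over [-R, R] is global.
    set R := 4 * |x| / m
    have hR : 0 ≤ R := by positivity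
    obtain ⟨η, -, hη⟩ := isCompact_Icc.exists_isMaxOn (s := Set.Icc (-R) R) ⟨0, by simpa⟩
      (f := fun α => α * x - F α) (by have := hd.continuous; fun_prop)
    refine ⟨η, fun α => ?_⟩
    by_cases hα : α ∈ Set.Icc (-R) R
    · exact hη hα
    · have hR' : R < |α| := by
        by_contra hcon
        exact hα (abs_le.1 (not_lt.1 hcon))
      have h1 : 4 * |x| < |α| * m := (div_lt_iff₀ hpos).1 hR'
      have h2 := le_freeEnergy lam κ γ α
      have h3 := mul_le_mul_of_nonneg_left (sq_div_four_le_cosh_sub_one α) hpos.le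
      have h4 : α * x ≤ |α| * |x| := (le_abs_self _).trans (abs_mul _ _).le
      have h5 : 0 * x - F 0 ≤ η * x - F η := hη ⟨by linarith, hR⟩
      rw [hFdef, freeEnergy_zero hγ] at h5
      have h6 : |α| * (4 * |x|) ≤ |α| * (|α| * m) := by gcongr
      have h7 : |α| * (|α| * m) = m * α ^ 2 := by rw [← sq_abs]; ring
      linarith

end RunTumble

/-! ### Large deviation principle, free energy and largest eigenvalue combined -/

theorem mainTheorem1 {Ω : Type*} [mΩ : MeasurableSpace Ω] (μ : Measure Ω) [IsProbabilityMeasure μ]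
    (ℱ : Filtration ℝ≥0 mΩ) (X : ℝ≥0 → Ω → ℤ) (V : ℝ≥0 → Ω → ℤˣ)
    (lam κ γ : ℝ) (hlam : 0 ≤ lam) (hκ : 0 ≤ κ) (hγ : 0 < γ)
    (hXV : RunTumble.IsRunAndTumble lam κ γ ℱ X V μ) :
    RunTumble.SatisfiesLDP μ (fun t ω => (X t ω : ℝ) / (t : ℝ))
        (RunTumble.legendre (RunTumble.freeEnergy lam κ γ)) ∧
      (∀ α : ℝ,
        (∀ t : ℝ≥0, Integrable (fun ω => Real.exp (α * (X t ω : ℝ))) μ) ∧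
        Tendsto (fun t : ℝ≥0 => 1 / (t : ℝ) * Real.log (∫ ω, Real.exp (α * (X t ω : ℝ)) ∂μ)) atTop
          (𝓝 (RunTumble.freeEnergy lam κ γ α))) ∧
      (∀ α : ℝ,
        Module.End.HasEigenvalue
          (Matrix.toLin' (RunTumble.fourierMatrix lam κ γ (-Complex.I * (α : ℂ))))
          ((RunTumble.freeEnergy lam κ γ α : ℝ) : ℂ) ∧
        ∀ z : ℂ,
          Module.End.HasEigenvalue
            (Matrix.toLin' (RunTumble.fourierMatrix lam κ γ (-Complex.I * (α : ℂ)))) z →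
          z.im = 0 ∧ z.re ≤ RunTumble.freeEnergy lam κ γ α) := by
  have hb := hXV.expMomentBounds hlam hκ hγ
  refine ⟨hb.satisfiesLDP (fun t => ?_) (RunTumble.freeEnergy_zero hγ lam κ) (fun α => ?_)
      (RunTumble.legendre_freeEnergy_eq_top_or hlam hκ hγ),
    fun α => ⟨fun t => ?_, hb.tendsto_log α⟩,
    fun α => ⟨RunTumble.hasEigenvalue_fourierMatrix hγ lam κ α,
      RunTumble.eigenvalue_fourierMatrix_le hγ lam κ α⟩⟩
  · exact (measurable_of_countable (Int.cast : ℤ → ℝ)).comp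
      (measurable_fst.comp (hXV.measurable_state t))
  · refine le_trans ?_ (RunTumble.le_freeEnergy lam κ γ α)
    have := sub_nonneg.2 (Real.one_le_cosh α)
    positivity
  · obtain ⟨_, _, _, _, h⟩ := hb α
    exact (h t).1
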